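/- Consider $n$ bins, initially empty, and a probability vector $p=(p_1,\dots,p_n)$, where $p_r$ is the probability that a ball is allocated to the bin of rank $r$, i.e. the $r$-th most heavily loaded bin. In the unweighted batched setting with batch size $b\ge 1$, balls of weight one are allocated one after the other in consecutive batches of $b$ balls; given the past, each ball is allocated according to $p$, with the ranking of the bins computed from the load vector at the beginning of the ball's batch. Bins of equal load are ranked either in a fixed way or with random tie-breaking (each ball, after sampling a rank, goes to a uniformly random bin among those having the same reported load as the bin of that rank). For $m\ge 0$ let $x^m$ be the load vector after $m$ balls (not necessarily at the end of a batch) and $\mathrm{Gap}(m)=\max_{i\in[n]}x_i^m-\frac mn$. For all constants $C>0$ and $0<c_1\le c_2$ there are a constant $k>0$ and an integer $n_0$, depending only on $C,c_1,c_2$, such that the following holds for every $n\ge n_0$, every probability vector $p$ with $\min_{i\in[n]}p_i\ge \frac Cn$, every batch size $b\ge 1$, both tie-breaking versions, and every integer $m$ with $c_1\, n\log n\le m\le c_2\, n\log n$: $$\Pr\left[\mathrm{Gap}(m)\ge k\cdot\log n\right]\ \ge\ 1-n^{-2}.$$ -/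

import Mathlib

namespace BatchedAllocation

/-- The bins sorted by decreasing load: `ranking x r` is the bin of rank `r` (rank `0` is the most
heavily loaded bin) for the load vector `x`; bins of equal load are ordered by label. -/
def ranking {n : ℕ} (x : Fin n → ℕ) : Equiv.Perm (Fin n) :=
  Tuple.sort fun i => OrderDual.toDual (x i)

theorem antitone_comp_ranking {n : ℕ} (x : Fin n → ℕ) : Antitone (x ∘ ranking x) :=
  fun _ _ h => Tuple.monotone_sort (fun i => OrderDual.toDual (x i)) h

/-- The two versions of the batched setting: bins of equal load are either ranked in a fixed
way, or each ball breaks ties uniformly at random. -/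
inductive TieBreaking
  | fixed
  | random

theorem tied_nonempty {n : ℕ} (x : Fin n → ℕ) (i : Fin n) :
    (Finset.univ.filter fun j => x j = x i).Nonempty :=
  ⟨i, by simp⟩

/-- The law of the bin that a ball is put into, when the process has probability vector `p`
(`p r` is the probability of the bin of rank `r`) and the reported load vector is `x`. -/
noncomputable def binLaw {n : ℕ} (tb : TieBreaking) (p : PMF (Fin n)) (x : Fin n → ℕ) :
    PMF (Fin n) :=
  match tb with
  | .fixed => p.map (ranking x)
  | .random => p.bind fun r =>
      PMF.uniformOfFinset (Finset.univ.filter fun j => x j = x (ranking x r))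
        (tied_nonempty x (ranking x r))

/-- With random tie-breaking, bin `i` is chosen with the average of the `p r` over all ranks `r`
whose bins have the same load as bin `i`. -/
theorem binLaw_random_apply {n : ℕ} (p : PMF (Fin n)) (x : Fin n → ℕ) (i : Fin n) :
    binLaw .random p x i =
      (∑ r ∈ Finset.univ.filter (fun r => x (ranking x r) = x i), p r) *
        ((Finset.univ.filter fun r => x (ranking x r) = x i).card : ENNReal)⁻¹ := by
  have hcard : (Finset.univ.filter fun r => x (ranking x r) = x i).card =
      (Finset.univ.filter fun j => x j = x i).card :=
    Finset.card_equiv (ranking x) (by simp)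
  rw [hcard, binLaw, PMF.bind_apply, tsum_fintype, Finset.sum_mul, Finset.sum_filter]
  refine Finset.sum_congr rfl fun r _ => ?_
  rw [PMF.uniformOfFinset_apply]
  by_cases h : x (ranking x r) = x i
  · simp [h]
  · simp [h, Ne.symm h]

/-- The unweighted batched process with batch size `b`. After `t` balls the state is a pair
`(s, x)`, where `x` is the current load vector and `s` is the load vector at the beginning of the
batch of the `t`-th ball. The next ball starts a new batch exactly if `b ∣ t`, and only then is the
reported load vector updated. -/
noncomputable def process {n : ℕ} (tb : TieBreaking) (b : ℕ) (p : PMF (Fin n)) :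
    ℕ → PMF ((Fin n → ℕ) × (Fin n → ℕ))
  | 0 => PMF.pure (0, 0)
  | t + 1 => (process tb b p t).bind fun sx =>
      let s := if b ∣ t then sx.2 else sx.1
      (binLaw tb p s).map fun i => (s, sx.2 + Pi.single i 1)

/-- The law of the load vector after `t` balls. -/
noncomputable def loadLaw {n : ℕ} (tb : TieBreaking) (b : ℕ) (p : PMF (Fin n)) (t : ℕ) :
    PMF (Fin n → ℕ) :=
  (process tb b p t).map Prod.snd

/-- The gap of the load vector `x` after `t` balls: maximum load minus average load. -/
noncomputable def gap {n : ℕ} (t : ℕ) (x : Fin n → ℕ) : ℝ :=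
  (⨆ i, (x i : ℝ)) - (t : ℝ) / n

end BatchedAllocation

/-! ### Binomial tails -/

namespace BatchedAllocation

/-! Whatever the reported loads, every bin receives every ball with probability at least `q = C /
n`. For a height `A` and `t` balls to go, take as potential the product over the bins of the
probability that a Bin(`t`, `q`) variable stays below the bin's distance to `A`. It is a
supermartingale (`sum_mul_prod_binomialTail_le`), so the dependent loads are no likelier to stay all
below `A` than independent binomials would be.

Start this `T ≈ k n log n` balls before time `m`, with `A ≈ m/n + k log n`. By averaging, some bin
has already reached `A`, or at least `n / L` bins are within `L = O(log n)` of it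
(`prod_binomialTail_le_exp`). For small `k` each of these climbs `L` with probability at least
`n^(-1/2)` (`exp_neg_le_one_sub_binomialTail`), so all fail with probability at most `exp(-√n / L) ≤
n⁻²`. -/

/-- The probability that a binomial variable with parameters `t` and `q` is smaller than `d`. -/
noncomputable def binomialTail (q : ℝ) : ℕ → ℕ → ℝ
  | 0, d => if d = 0 then 0 else 1
  | t + 1, d => (1 - q) * binomialTail q t d + q * binomialTail q t (d - 1)

theorem binomialTail_zero_right (q : ℝ) (t : ℕ) : binomialTail q t 0 = 0 := by
  induction t with
  | zero => simp [binomialTail]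
  | succ t ih => simp [binomialTail, ih]

theorem binomialTail_nonneg {q : ℝ} (h0 : 0 ≤ q) (h1 : q ≤ 1) (t d : ℕ) :
    0 ≤ binomialTail q t d := by
  induction t generalizing d with
  | zero => rw [binomialTail]; split_ifs <;> norm_num
  | succ t ih =>
    exact add_nonneg (mul_nonneg (sub_nonneg.2 h1) (ih _)) (mul_nonneg h0 (ih _))

theorem binomialTail_le_one {q : ℝ} (h0 : 0 ≤ q) (h1 : q ≤ 1) (t d : ℕ) :
    binomialTail q t d ≤ 1 := by
  induction t generalizing d with
  | zero => rw [binomialTail]; split_ifs <;> norm_num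
  | succ t ih =>
    rw [binomialTail]
    nlinarith [mul_le_mul_of_nonneg_left (ih d) (sub_nonneg.2 h1),
      mul_le_mul_of_nonneg_left (ih (d - 1)) h0]

theorem monotone_binomialTail {q : ℝ} (h0 : 0 ≤ q) (h1 : q ≤ 1) (t : ℕ) :
    Monotone (binomialTail q t) := by
  induction t with
  | zero =>
    intro d e hde
    simp only [binomialTail]
    split_ifs <;> first | omega | norm_num
  | succ t ih =>
    intro d e hde
    exact add_le_add (mul_le_mul_of_nonneg_left (ih hde) (sub_nonneg.2 h1))
      (mul_le_mul_of_nonneg_left (ih (Nat.sub_le_sub_right hde 1)) h0)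

/-- Pascal's rule, for the event of exactly `d` successes; the exponent `t` in place of `t - d`
weakens the bound but avoids subtraction. -/
theorem choose_mul_le_one_sub_binomialTail {q : ℝ} (h0 : 0 ≤ q) (h1 : q ≤ 1) (t d : ℕ) :
    (t.choose d : ℝ) * q ^ d * (1 - q) ^ t ≤ 1 - binomialTail q t d := by
  induction t generalizing d with
  | zero => cases d <;> simp [binomialTail]
  | succ t ih =>
    have hq : 0 ≤ 1 - q := sub_nonneg.2 h1
    cases d with
    | zero =>
      rw [binomialTail_zero_right]
      simpa using pow_le_one₀ hq (by linarith : 1 - q ≤ 1)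
    | succ d =>
      have e1 := mul_le_mul_of_nonneg_left (ih (d + 1)) hq
      have e2 := mul_le_mul_of_nonneg_left (ih d) h0
      have e3 : q * (t.choose d * q ^ d * (1 - q) ^ t) * (1 - q) ≤
          q * (t.choose d * q ^ d * (1 - q) ^ t) :=
        mul_le_of_le_one_right (by positivity) (by linarith)
      rw [binomialTail, Nat.choose_succ_succ, Nat.add_sub_cancel]
      push_cast
      calc _ = (1 - q) * (t.choose (d + 1) * q ^ (d + 1) * (1 - q) ^ t) +
            q * (t.choose d * q ^ d * (1 - q) ^ t) * (1 - q) := by ring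
        _ ≤ _ := by linarith

/-! ### Comparison with independent bins -/

/-- A multilinear form of the Weierstrass product inequality. -/
theorem prod_sub_sum_le_prod {ι : Type*} [DecidableEq ι] (s : Finset ι) {a b : ι → ℝ} {q : ℝ}
    (h0 : 0 ≤ q) (h1 : q ≤ 1) (hb : ∀ i, 0 ≤ b i) (hab : ∀ i, b i ≤ a i) :
    ∏ i ∈ s, a i - ∑ i ∈ s, q * (a i - b i) * ∏ j ∈ s.erase i, a j ≤
      ∏ i ∈ s, ((1 - q) * a i + q * b i) := by
  induction s using Finset.induction_on with
  | empty => simp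
  | insert k s hk ih =>
    have ha : ∀ i, 0 ≤ a i := fun i => (hb i).trans (hab i)
    have hle : ∏ i ∈ s, ((1 - q) * a i + q * b i) ≤ ∏ i ∈ s, a i := by
      refine Finset.prod_le_prod (fun i _ => ?_) fun i _ => ?_
      · exact add_nonneg (mul_nonneg (sub_nonneg.2 h1) (ha i)) (mul_nonneg h0 (hb i))
      · nlinarith [mul_le_mul_of_nonneg_left (hab i) h0]
    have hsum : ∑ i ∈ s, q * (a i - b i) * ∏ j ∈ (insert k s).erase i, a j =
        a k * ∑ i ∈ s, q * (a i - b i) * ∏ j ∈ s.erase i, a j := by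
      rw [Finset.mul_sum]
      refine Finset.sum_congr rfl fun i hi => ?_
      have hik : k ≠ i := fun h => hk (h ▸ hi)
      rw [Finset.erase_insert_of_ne hik,
        Finset.prod_insert fun h => hk (Finset.mem_of_mem_erase h)]
      ring
    rw [Finset.prod_insert hk, Finset.prod_insert hk, Finset.sum_insert hk, hsum,
      Finset.erase_insert hk]
    have e1 := mul_le_mul_of_nonneg_left ih (ha k)
    have e2 := mul_le_mul_of_nonneg_left hle (mul_nonneg h0 (sub_nonneg.2 (hab k)))
    linarith

/-- If every bin receives the next ball with probability at least `q`, then the product of the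
binomial tails at the remaining distances to the height `A` does not increase on average. -/
theorem sum_mul_prod_binomialTail_le {n : ℕ} {w : Fin n → ℝ} {q : ℝ} (h0 : 0 ≤ q) (h1 : q ≤ 1)
    (hw : ∀ i, q ≤ w i) (hsum : ∑ i, w i = 1) (A t : ℕ) (x : Fin n → ℕ) :
    ∑ i, w i * ∏ j, binomialTail q t (A - (x + Pi.single i 1 : Fin n → ℕ) j) ≤
      ∏ j, binomialTail q (t + 1) (A - x j) := by
  set a : Fin n → ℝ := fun j => binomialTail q t (A - x j)
  set b : Fin n → ℝ := fun j => binomialTail q t (A - x j - 1)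
  have hb : ∀ i, 0 ≤ b i := fun i => binomialTail_nonneg h0 h1 _ _
  have hab : ∀ i, b i ≤ a i := fun i => monotone_binomialTail h0 h1 t (Nat.sub_le _ _)
  have hP : ∀ i, ∏ j, a j = a i * ∏ j ∈ Finset.univ.erase i, a j := fun i =>
    (Finset.mul_prod_erase _ _ (Finset.mem_univ i)).symm
  -- A ball changes a single factor, so the mean drop is linear in the weights `w i`, which can then
  -- be lowered to `q`.
  have hterm : ∀ i, ∏ j, binomialTail q t (A - (x + Pi.single i 1 : Fin n → ℕ) j) =
      ∏ j, a j - (a i - b i) * ∏ j ∈ Finset.univ.erase i, a j := by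
    intro i
    rw [hP i, ← Finset.mul_prod_erase _ _ (Finset.mem_univ i)]
    have hi : binomialTail q t (A - (x + Pi.single i 1 : Fin n → ℕ) i) = b i := by
      simp [b, Nat.sub_sub]
    have hj : ∏ j ∈ Finset.univ.erase i, binomialTail q t (A - (x + Pi.single i 1 : Fin n → ℕ) j) =
        ∏ j ∈ Finset.univ.erase i, a j := by
      refine Finset.prod_congr rfl fun j hj => ?_
      simp [a, Pi.single_eq_of_ne (Finset.ne_of_mem_erase hj)]
    rw [hi, hj]
    ring
  calc _ = ∏ j, a j - ∑ i, w i * ((a i - b i) * ∏ j ∈ Finset.univ.erase i, a j) := by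
        simp only [hterm, mul_sub, Finset.sum_sub_distrib, ← Finset.sum_mul, hsum, one_mul]
    _ ≤ ∏ j, a j - ∑ i, q * (a i - b i) * ∏ j ∈ Finset.univ.erase i, a j := by
        refine sub_le_sub_left (Finset.sum_le_sum fun i _ => ?_) _
        rw [mul_assoc]
        exact mul_le_mul_of_nonneg_right (hw i) (mul_nonneg (sub_nonneg.2 (hab i))
          (Finset.prod_nonneg fun j _ => (hb j).trans (hab j)))
    _ ≤ _ := prod_sub_sum_le_prod _ h0 h1 hb hab

/-! ### The potential along the process -/

theorem tsum_bind_mul {α β : Type*} (P : PMF α) (f : α → PMF β) (F : β → ENNReal) :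
    ∑' b, P.bind f b * F b = ∑' a, P a * ∑' b, f a b * F b := by
  simp only [PMF.bind_apply, ← ENNReal.tsum_mul_right, ← ENNReal.tsum_mul_left]
  rw [ENNReal.tsum_comm]
  simp only [mul_assoc]

theorem tsum_map_mul {α β : Type*} (P : PMF α) (g : α → β) (F : β → ENNReal) :
    ∑' b, P.map g b * F b = ∑' a, P a * F (g a) := by
  classical
  rw [PMF.map, tsum_bind_mul]
  refine tsum_congr fun a => ?_
  congr 1
  rw [tsum_eq_single (g a) fun b hb => by simp [hb]]
  simp

theorem sum_toReal_eq_one {α : Type*} [Fintype α] (P : PMF α) : ∑ i, (P i).toReal = 1 := by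
  rw [← ENNReal.toReal_sum fun i _ => P.apply_ne_top i, ← tsum_fintype (L := .unconditional α),
    P.tsum_coe, ENNReal.toReal_one]

theorem le_binLaw {n : ℕ} (tb : TieBreaking) (p : PMF (Fin n)) (x : Fin n → ℕ) {c : ENNReal}
    (hp : ∀ i, c ≤ p i) (i : Fin n) : c ≤ binLaw tb p x i := by
  classical
  cases tb with
  | fixed =>
    have h : binLaw .fixed p x (ranking x ((ranking x).symm i)) = p ((ranking x).symm i) := by
      rw [binLaw, PMF.map_apply, tsum_eq_single ((ranking x).symm i)]
      · simp
      · intro j hj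
        rw [if_neg]
        intro h
        exact hj ((ranking x).injective h).symm
    rw [Equiv.apply_symm_apply] at h
    exact h ▸ hp _
  | random =>
    rw [binLaw_random_apply]
    set s := Finset.univ.filter fun r => x (ranking x r) = x i
    have hs : s.card ≠ 0 := by
      refine Finset.card_ne_zero_of_mem (a := (ranking x).symm i) ?_
      simp [s]
    have h : (s.card : ENNReal) * c ≤ ∑ r ∈ s, p r := by
      simpa using Finset.card_nsmul_le_sum s (fun r => p r) c fun r _ => hp r
    calc c = s.card * c * (s.card : ENNReal)⁻¹ := by
          rw [mul_right_comm, ENNReal.mul_inv_cancel (by exact_mod_cast hs)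
            (ENNReal.natCast_ne_top _), one_mul]
      _ ≤ _ := by gcongr

/-- Supermartingale step. `le_binLaw` holds for any reported vector `s`, however outdated, so the
batch size plays no role. -/
theorem tsum_process_succ_le {n : ℕ} (tb : TieBreaking) (b : ℕ) (p : PMF (Fin n)) {q : ℝ}
    (h0 : 0 ≤ q) (h1 : q ≤ 1) (hp : ∀ i, q ≤ (p i).toReal) (A m t : ℕ) :
    ∑' z, process tb b p (m + 1) z *
        ENNReal.ofReal (∏ j, binomialTail q t (A - z.2 j)) ≤
      ∑' z, process tb b p m z *
        ENNReal.ofReal (∏ j, binomialTail q (t + 1) (A - z.2 j)) := by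
  rw [process, tsum_bind_mul]
  refine ENNReal.tsum_le_tsum fun z => mul_le_mul_right ?_ _
  set s := if b ∣ m then z.2 else z.1
  rw [tsum_map_mul, tsum_fintype]
  have hw : ∀ i, q ≤ (binLaw tb p s i).toReal := fun i => by
    have h := le_binLaw tb p s (c := ENNReal.ofReal q)
      (fun i => ENNReal.ofReal_le_of_le_toReal (hp i)) i
    exact (ENNReal.ofReal_le_iff_le_toReal (PMF.apply_ne_top _ _)).1 h
  refine le_trans (le_of_eq ?_) (ENNReal.ofReal_le_ofReal
    (sum_mul_prod_binomialTail_le h0 h1 hw (sum_toReal_eq_one _) A t z.2))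
  have hn : ∀ i, 0 ≤ ∏ j, binomialTail q t (A - (z.2 + Pi.single i 1 : Fin n → ℕ) j) := fun i =>
    Finset.prod_nonneg fun j _ => binomialTail_nonneg h0 h1 _ _
  rw [ENNReal.ofReal_sum_of_nonneg fun i _ => mul_nonneg ENNReal.toReal_nonneg (hn i)]
  refine Finset.sum_congr rfl fun i _ => ?_
  rw [ENNReal.ofReal_mul ENNReal.toReal_nonneg, ENNReal.ofReal_toReal (PMF.apply_ne_top _ _)]

theorem tsum_process_add_le {n : ℕ} (tb : TieBreaking) (b : ℕ) (p : PMF (Fin n)) {q : ℝ}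
    (h0 : 0 ≤ q) (h1 : q ≤ 1) (hp : ∀ i, q ≤ (p i).toReal) (A m t T : ℕ) :
    ∑' z, process tb b p (m + T) z *
        ENNReal.ofReal (∏ j, binomialTail q t (A - z.2 j)) ≤
      ∑' z, process tb b p m z *
        ENNReal.ofReal (∏ j, binomialTail q (t + T) (A - z.2 j)) := by
  induction T generalizing t with
  | zero => rfl
  | succ T ih =>
    refine (tsum_process_succ_le tb b p h0 h1 hp A (m + T) t).trans ?_
    have := ih (t + 1)
    rwa [Nat.add_right_comm] at this

theorem sum_snd_of_mem_support_process {n : ℕ} (tb : TieBreaking) (b : ℕ) (p : PMF (Fin n))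
    (t : ℕ) : ∀ z ∈ (process tb b p t).support, ∑ i, z.2 i = t := by
  induction t with
  | zero =>
    intro z hz
    rw [process, PMF.support_pure, Set.mem_singleton_iff] at hz
    simp [hz]
  | succ t ih =>
    intro z hz
    rw [process, PMF.mem_support_bind_iff] at hz
    obtain ⟨y, hy, hz⟩ := hz
    rw [PMF.mem_support_map_iff] at hz
    obtain ⟨i, -, rfl⟩ := hz
    simp [Finset.sum_add_distrib, ih y hy]

/-- The probability that all loads stay below `A` is at most any uniform bound for the product of
the binomial tails over the load vectors that can occur `T` balls earlier. -/
theorem toMeasure_loadLaw_lt_le {n : ℕ} (tb : TieBreaking) (b : ℕ) (p : PMF (Fin n)) {q : ℝ}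
    (h0 : 0 ≤ q) (h1 : q ≤ 1) (hp : ∀ i, q ≤ (p i).toReal) (A m T : ℕ) {ε : ℝ}
    (hε : ∀ x : Fin n → ℕ, ∑ i, x i = m → ∏ j, binomialTail q T (A - x j) ≤ ε) :
    (loadLaw tb b p (m + T)).toMeasure {x | ∀ i, x i < A} ≤ ENNReal.ofReal ε := by
  -- With no balls left, the potential is the indicator that all loads are below `A`.
  have hind : (loadLaw tb b p (m + T)).toMeasure {x | ∀ i, x i < A} ≤
      ∑' x, loadLaw tb b p (m + T) x *
        ENNReal.ofReal (∏ j, binomialTail q 0 (A - x j)) := by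
    rw [PMF.toMeasure_apply_eq_tsum]
    refine ENNReal.tsum_le_tsum fun x => ?_
    by_cases hx : ∀ i, x i < A
    · rw [Set.indicator_of_mem (show x ∈ {x : Fin n → ℕ | ∀ i, x i < A} from hx)]
      have : ∏ j, binomialTail q 0 (A - x j) = 1 :=
        Finset.prod_eq_one fun j _ => by
          rw [binomialTail, if_neg (Nat.sub_ne_zero_of_lt (hx j))]
      simp [this]
    · rw [Set.indicator_of_notMem (show x ∉ {x : Fin n → ℕ | ∀ i, x i < A} from hx)]
      exact zero_le
  refine hind.trans ?_
  rw [loadLaw, tsum_map_mul]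
  refine (tsum_process_add_le tb b p h0 h1 hp A m 0 T).trans ?_
  rw [Nat.zero_add]
  calc _ ≤ ∑' z, process tb b p m z * ENNReal.ofReal ε := by
        refine ENNReal.tsum_le_tsum fun z => ?_
        by_cases hz : z ∈ (process tb b p m).support
        · exact mul_le_mul_right (ENNReal.ofReal_le_ofReal
            (hε _ (sum_snd_of_mem_support_process tb b p m z hz))) _
        · rw [(PMF.apply_eq_zero_iff _ _).2 hz, zero_mul, zero_mul]
    _ = _ := by rw [ENNReal.tsum_mul_right, PMF.tsum_coe, one_mul]

end BatchedAllocation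
-- Quantitative estimates
namespace BatchedAllocation

theorem exp_neg_le_one_sub_binomialTail {C y : ℝ} (hC : 0 < C) (hC1 : C ≤ 1) {n T L : ℕ}
    (hn : 12 ≤ n) (hL : 1 ≤ L) (hLy : (L : ℝ) ≤ 3 * y) (hT : n * y / 2 ≤ T)
    (hTy : (T : ℝ) ≤ n * y) :
    Real.exp (-((3 * Real.log (12 / C) + 2) * y)) ≤ 1 - binomialTail (C / n) T L := by
  have hn' : (12 : ℝ) ≤ n := by exact_mod_cast hn
  have hn0 : (0 : ℝ) < n := by linarith
  have hL0 : (0 : ℝ) < L := by exact_mod_cast hL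
  have hq0 : 0 < C / n := by positivity
  have hq2 : C / n ≤ 1 / 2 := by rw [div_le_iff₀ hn0]; linarith
  refine le_trans ?_ (choose_mul_le_one_sub_binomialTail hq0.le (by linarith) T L)
  have hLT : (L : ℝ) ≤ T / 2 := by nlinarith
  have hLT' : L ≤ T + 1 := by
    have : (L : ℝ) ≤ (T + 1 : ℕ) := by push_cast; linarith
    exact_mod_cast this
  -- The 12 comes from `T ≥ n y / 2` and `L ≤ 3 y`.
  have hbase : C / 12 ≤ T / 2 / L * (C / n) := by
    rw [div_div, div_mul_div_comm, div_le_div_iff₀ (by norm_num) (by positivity)]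
    have : 2 * (L : ℝ) * n ≤ 12 * T := by nlinarith
    nlinarith
  have hchoose : ((T : ℝ) / 2 / L) ^ L ≤ T.choose L := by
    refine le_trans ?_ (Nat.pow_le_choose (α := ℝ) L T)
    rw [div_pow]
    gcongr
    · rw [Nat.cast_sub hLT']
      push_cast
      linarith
    · exact_mod_cast Nat.factorial_le_pow L
  have h12 : 0 ≤ Real.log (12 / C) :=
    Real.log_nonneg (by rw [le_div_iff₀ hC]; linarith)
  have hpow : Real.exp (-(3 * Real.log (12 / C) * y)) ≤ (C / 12) ^ L := by
    have e : C / 12 = Real.exp (-Real.log (12 / C)) := by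
      rw [← Real.log_inv, inv_div, Real.exp_log (by positivity)]
    rw [e, ← Real.exp_nat_mul, Real.exp_le_exp]
    nlinarith
  have hexp : Real.exp (-(2 * y)) ≤ (1 - C / n) ^ T := by
    have h1 : Real.exp (-(2 * (C / n))) ≤ 1 - C / n := by
      rw [← Real.le_log_iff_exp_le (by linarith)]
      refine le_trans ?_ (Real.one_sub_inv_le_log_of_pos (by linarith))
      have : (1 - C / n)⁻¹ ≤ 1 + 2 * (C / n) := by
        rw [inv_le_iff_one_le_mul₀ (by linarith)]
        nlinarith
      linarith
    refine le_trans ?_ (pow_le_pow_left₀ (Real.exp_pos _).le h1 T)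
    rw [← Real.exp_nat_mul, Real.exp_le_exp]
    have : T * (C / n) ≤ y := by
      rw [← mul_div_assoc, div_le_iff₀ hn0]
      nlinarith [(Nat.cast_nonneg T : (0 : ℝ) ≤ T)]
    linarith
  calc _ = Real.exp (-(3 * Real.log (12 / C) * y)) * Real.exp (-(2 * y)) := by
        rw [← Real.exp_add]; ring_nf
    _ ≤ (C / 12) ^ L * (1 - C / n) ^ T := by gcongr
    _ ≤ (T / 2 / L * (C / n)) ^ L * (1 - C / n) ^ T := by
        have : 0 ≤ 1 - C / n := by linarith
        gcongr
    _ ≤ _ := by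
        have : 0 ≤ 1 - C / n := by linarith
        rw [mul_pow]
        gcongr

/-- A load vector has at least `n / L` bins within distance `L` of the height `A`, unless some load
is at least `A` already; here `A` exceeds the average load by at most `L - 1`. -/
theorem prod_binomialTail_le_exp {n : ℕ} (hn : 0 < n) {q u : ℝ} (h0 : 0 ≤ q) (h1 : q ≤ 1)
    {A L T m : ℕ} (hL : 1 ≤ L) (hu : 0 ≤ u) (huL : u ≤ 1 - binomialTail q T L)
    (hA : (A : ℝ) + 1 ≤ (m : ℝ) / n + L) (x : Fin n → ℕ) (hx : ∑ i, x i = m) :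
    ∏ j, binomialTail q T (A - x j) ≤ Real.exp (-(u * (n / L))) := by
  have hnn := fun d => binomialTail_nonneg h0 h1 T d
  by_cases hlt : ∀ i, x i < A
  swap
  · push Not at hlt
    obtain ⟨i, hi⟩ := hlt
    rw [Finset.prod_eq_zero (Finset.mem_univ i)]
    · exact (Real.exp_pos _).le
    · rw [Nat.sub_eq_zero_of_le hi, binomialTail_zero_right]
  have hn' : (0 : ℝ) < n := by exact_mod_cast hn
  have hL0 : (0 : ℝ) < L := by exact_mod_cast hL
  set S := Finset.univ.filter fun i => (m : ℝ) / n - 1 ≤ x i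
  have hcard : (n : ℝ) / L ≤ S.card := by
    rw [div_le_iff₀ hL0]
    -- The shift by 1 makes the sum `n`; terms outside `S` are negative and those in `S` are at most
    -- `L`.
    have hsum : ∑ i, ((x i : ℝ) - m / n + 1) = n := by
      rw [Finset.sum_add_distrib, Finset.sum_sub_distrib, ← Nat.cast_sum, hx]
      simp
      field_simp
      ring
    calc (n : ℝ) = ∑ i, ((x i : ℝ) - m / n + 1) := hsum.symm
      _ ≤ ∑ i, if (m : ℝ) / n - 1 ≤ x i then (L : ℝ) else 0 := by
          refine Finset.sum_le_sum fun i _ => ?_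
          have : (x i : ℝ) + 1 ≤ A := by exact_mod_cast hlt i
          split_ifs <;> linarith
      _ = S.card * L := by
          rw [← Finset.sum_filter, Finset.sum_const, nsmul_eq_mul]
  calc ∏ j, binomialTail q T (A - x j) ≤ ∏ j ∈ S, binomialTail q T (A - x j) :=
        Finset.prod_le_prod_of_subset_of_le_one (Finset.subset_univ _) (fun j _ => hnn _)
          fun j _ _ => binomialTail_le_one h0 h1 T _
    _ ≤ ∏ j ∈ S, Real.exp (-u) := by
        refine Finset.prod_le_prod (fun j _ => hnn _) fun j hj => ?_
        have hj' : (m : ℝ) / n - 1 ≤ x j := (Finset.mem_filter.1 hj).2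
        have hle : A - x j ≤ L := by
          have : (A : ℝ) ≤ (L + x j : ℕ) := by push_cast; linarith
          have : A ≤ L + x j := by exact_mod_cast this
          omega
        have := monotone_binomialTail h0 h1 T hle
        have := Real.one_sub_le_exp_neg u
        linarith
    _ = Real.exp (-(u * S.card)) := by
        rw [Finset.prod_const, ← Real.exp_nat_mul]
        ring_nf
    _ ≤ _ := by
        rw [Real.exp_le_exp]
        exact neg_le_neg (mul_le_mul_of_nonneg_left hcard hu)

end BatchedAllocation

/-! ### Choice of constants and conclusion -/

theorem mainTheorem7 (C c₁ c₂ : ℝ) (hC : 0 < C) (hc₁ : 0 < c₁) (hc : c₁ ≤ c₂) :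
    ∃ k : ℝ, 0 < k ∧ ∃ n₀ : ℕ, ∀ n : ℕ, n₀ ≤ n →
      ∀ p : PMF (Fin n), (∀ i, C / n ≤ (p i).toReal) →
      ∀ b : ℕ, 1 ≤ b → ∀ tb : BatchedAllocation.TieBreaking,
      ∀ m : ℕ, c₁ * (n * Real.log n) ≤ m → (m : ℝ) ≤ c₂ * (n * Real.log n) →
        1 - 1 / (n : ℝ) ^ 2 ≤
          (BatchedAllocation.loadLaw tb b p m).toMeasure.real
            {x | k * Real.log n ≤ BatchedAllocation.gap m x} := by
  open BatchedAllocation in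
  -- The absolute value keeps `K` positive before `C ≤ 1` is known.
  set K : ℝ := 3 * |Real.log (12 / C)| + 2 with hK
  have hK0 : 0 < K := by positivity
  -- `k ≤ c₁` gives `T ≤ m`; `K * k ≤ 1 / 2` makes the climbing probability at least `n^(-1/2)`.
  set k : ℝ := min c₁ (1 / (2 * K))
  have hk0 : 0 < k := lt_min hc₁ (by positivity)
  have hkK : K * k ≤ 1 / 2 := by
    calc K * k ≤ K * (1 / (2 * K)) := mul_le_mul_of_nonneg_left (min_le_right _ _) hK0.le
      _ = 1 / 2 := by field_simp
  refine ⟨k, hk0, ?_⟩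
  have hlog : Filter.Tendsto (fun n : ℕ => Real.log n) Filter.atTop Filter.atTop :=
    Real.tendsto_log_atTop.comp tendsto_natCast_atTop_atTop
  have hlim : Filter.Tendsto (fun y : ℝ => 6 * k * (y ^ 2 * Real.exp (-(1 / 2) * y)))
      Filter.atTop (nhds 0) := by
    have h := tendsto_rpow_mul_exp_neg_mul_atTop_nhds_zero 2 (1 / 2) (by norm_num)
    simpa using h.const_mul (6 * k)
  have hsmall := hlog.eventually (hlim.eventually_le_const one_pos)
  obtain ⟨n₀, h₀⟩ := Filter.eventually_atTop.1
    ((hsmall.and (hlog.eventually_ge_atTop (3 / k))).and (Filter.eventually_ge_atTop 12))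
  refine ⟨n₀, fun n hn p hp b _ tb m hm _ => ?_⟩
  obtain ⟨⟨hs, hlk⟩, hn12⟩ := h₀ n hn
  have hn12' : (12 : ℝ) ≤ n := by exact_mod_cast hn12
  have hn0 : (0 : ℝ) < n := by linarith
  set l := Real.log n
  have hl0 : 0 < l := lt_of_lt_of_le (by positivity) hlk
  have hkl : 3 ≤ k * l := by
    rw [div_le_iff₀ hk0] at hlk
    linarith
  have hC1 : C ≤ 1 := by
    have h := Finset.sum_le_sum fun i (_ : i ∈ Finset.univ) => hp i
    rw [sum_toReal_eq_one] at h
    simp only [Finset.sum_const, Finset.card_univ, Fintype.card_fin, nsmul_eq_mul] at h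
    rwa [mul_div_cancel₀ _ hn0.ne'] at h
  have hq1 : C / n ≤ 1 := by rw [div_le_one hn0]; linarith
  set T := ⌊n * (k * l)⌋₊
  have hTle : (T : ℝ) ≤ n * (k * l) := Nat.floor_le (by positivity)
  have hTge : n * (k * l) / 2 ≤ T := by
    have := Nat.lt_floor_add_one (n * (k * l))
    have : (2 : ℝ) ≤ n * (k * l) := by nlinarith
    linarith
  have hTm : T ≤ m := by
    have h : k * (n * l) ≤ c₁ * (n * l) :=
      mul_le_mul_of_nonneg_right (min_le_left _ _) (by positivity)
    have : (T : ℝ) ≤ m := by linarith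
    exact_mod_cast this
  obtain ⟨m₀, rfl⟩ := Nat.exists_eq_add_of_le' hTm
  set A := ⌈((m₀ + T : ℕ) : ℝ) / n + k * l⌉₊ with hAdef
  -- One `k * l` is the target gap, the other bounds the growth `T / n` of the average; the 2 covers
  -- the ceiling in `A` and the 1 in `hA`.
  set L := ⌈2 * (k * l)⌉₊ + 2
  have hL3 : (L : ℝ) ≤ 3 * (k * l) := by
    have := Nat.ceil_lt_add_one (show 0 ≤ 2 * (k * l) by positivity)
    simp only [L]
    push_cast
    linarith
  have hA : (A : ℝ) + 1 ≤ (m₀ : ℝ) / n + L := by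
    have h1 := Nat.ceil_lt_add_one (show 0 ≤ ((m₀ + T : ℕ) : ℝ) / n + k * l by positivity)
    have h2 := Nat.le_ceil (2 * (k * l))
    have h3 : (T : ℝ) / n ≤ k * l := by rw [div_le_iff₀ hn0]; linarith
    rw [← hAdef] at h1
    push_cast [L, add_div] at h1 ⊢
    linarith
  have hu := exp_neg_le_one_sub_binomialTail hC hC1 hn12 (Nat.le_add_left 1 _)
    hL3 hTge hTle
  have hbound : Real.exp (-(Real.exp (-((3 * Real.log (12 / C) + 2) * (k * l))) * (n / L))) ≤
      1 / (n : ℝ) ^ 2 := by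
    have hn2 : 1 / (n : ℝ) ^ 2 = Real.exp (-(2 * l)) := by
      rw [Real.exp_neg, two_mul, Real.exp_add, Real.exp_log hn0, one_div, sq]
    rw [hn2, Real.exp_le_exp]
    refine neg_le_neg ?_
    have h1 : Real.exp (-(l / 2)) ≤
        Real.exp (-((3 * Real.log (12 / C) + 2) * (k * l))) := by
      rw [Real.exp_le_exp]
      refine neg_le_neg ?_
      have hle : 3 * Real.log (12 / C) + 2 ≤ K := by
        linarith [le_abs_self (Real.log (12 / C))]
      calc _ ≤ K * (k * l) := mul_le_mul_of_nonneg_right hle (by positivity)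
        _ = K * k * l := by ring
        _ ≤ 1 / 2 * l := mul_le_mul_of_nonneg_right hkK hl0.le
        _ = l / 2 := by ring
    have hsq : Real.exp (-(l / 2)) * n = Real.exp (l / 2) := by
      rw [← Real.exp_log hn0, ← Real.exp_add]
      congr 1
      ring
    -- `6 * k * l ^ 2` bounds `2 * l * L`, as `L ≤ 3 * (k * l)`.
    have h6 : 6 * k * l ^ 2 ≤ Real.exp (l / 2) := by
      have e : Real.exp (-(1 / 2) * l) = (Real.exp (l / 2))⁻¹ := by
        rw [← Real.exp_neg]
        congr 1
        ring
      rw [e, ← mul_assoc, ← div_eq_mul_inv, div_le_one (Real.exp_pos _)] at hs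
      exact hs
    have hLpos : (0 : ℝ) < L := by positivity
    calc 2 * l ≤ Real.exp (l / 2) / L := by
          rw [le_div_iff₀ hLpos]
          nlinarith
      _ = Real.exp (-(l / 2)) * (n / L) := by rw [← hsq, mul_div_assoc]
      _ ≤ _ := by gcongr
  have hmain := toMeasure_loadLaw_lt_le tb b p (q := C / n) (by positivity) hq1 hp A m₀ T
    fun x hx => (prod_binomialTail_le_exp (by omega) (by positivity) hq1 (Nat.le_add_left 1 _)
      (Real.exp_pos _).le hu hA x hx).trans hbound
  set μ := (loadLaw tb b p (m₀ + T)).toMeasure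
  have hcompl : {x : Fin n → ℕ | k * l ≤ gap (m₀ + T) x}ᶜ ⊆ {x | ∀ i, x i < A} := by
    intro x hx i
    have hx' : gap (m₀ + T) x < k * l := not_le.1 hx
    rw [gap] at hx'
    have := le_ciSup (Set.finite_range fun i => (x i : ℝ)).bddAbove i
    rw [hAdef, Nat.lt_ceil]
    linarith
  have hreal : μ.real {x : Fin n → ℕ | k * l ≤ gap (m₀ + T) x}ᶜ ≤ 1 / (n : ℝ) ^ 2 :=
    ENNReal.toReal_le_of_le_ofReal (by positivity)
      ((MeasureTheory.measure_mono hcompl).trans hmain)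
  rw [MeasureTheory.probReal_compl_eq_one_sub (Set.to_countable _).measurableSet] at hreal
  linarith
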